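/- All groups are finite, and $k$ ranges over $\mathbb{N}$. Let $A$ be a finite set and $\chi_0$ a colouring of $A^k$. Colour refinement defines, for $\bar g\in A^k$, \[\chi_{i+1}(\bar g)=\bigl(\chi_i(\bar g),\{\!\!\{(\chi_i(\bar g_{|1\leftarrow x}),\dots,\chi_i(\bar g_{|k\leftarrow x}))\mid x\in A\}\!\!\}\bigr),\] where $\bar g_{|j\leftarrow x}$ is $\bar g$ with its $j$-th entry replaced by $x$ and $\{\!\!\{\cdots\}\!\!\}$ denotes a multiset. To compare two structures, they are refined in parallel; the final colouring is $\chi_i$ for the first $i$ such that $\chi_i$ and $\chi_{i+1}$ induce the same partition of all $k$-tuples of the two structures. The three versions of the $k$-dimensional Weisfeiler-Leman algorithm for groups are: Version I: colour refinement on $G^k$ where $(g_1,\dots,g_k)$ and $(h_1,\dots,h_k)$ get the same initial colour iff for all $i,j,m$: $g_i=g_j\Leftrightarrow h_i=h_j$ and $g_ig_j=g_m\Leftrightarrow h_ih_j=h_m$. Version II: colour refinement on $G^k$ where $(g_1,\dots,g_k)$ and $(h_1,\dots,h_k)$ get the same initial colour iff $g_i\mapsto h_i$ extends to an isomorphism $\langle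 g_1,\dots,g_k\rangle\to\langle h_1,\dots,h_k\rangle$. Version III (for $k\ge 2$): let $\Gamma_G$ be the graph whose vertices are the elements of $G$ and, for each $(g,h)\in G^2$, four further vertices $a_{gh},b_{gh},c_{gh},d_{gh}$, with the edges $\{g,a_{gh}\},\{h,b_{gh}\},\{gh,d_{gh}\},\{a_{gh},b_{gh}\},\{b_{gh},c_{gh}\},\{c_{gh},d_{gh}\}$. Apply colour refinement to $V(\Gamma_G)^k$, where two tuples $(v_i)$, $(w_i)$ get the same initial colour iff $v_i\mapsto w_i$ is an isomorphism of the induced subgraphs, and restrict the final colouring to $G^k$. Write $G\equiv_{WL_k^J}H$ if there is a bijection $G^k\to H^k$ preserving the final colours of Version $J$, and $WL_k^J\preceq WL_{k'}^{J'}$ if $G\equiv_{WL_{k'}^{J'}}H$ implies $G\equiv_{WL_k^J}H$ for all finite groups $G,H$. Theorem. For every $k\in\mathbb{N}$, \[WL_k^{\mathrm I}\preceq WL_k^{\mathrm{II}}\preceq WL_{\lceil k/2\rceil+2}^{\mathrm{III}}\preceq WL_{2\lceil k/2\rceil+5}^{\mathrm I}\quad\text{and}\quad WL_{\lfloor k/2\rfloor+2}^{\mathrm{III}}\preceq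 WL_{k+5}^{\mathrm I}.\] In particular, for every even $k$, $WL_k^{\mathrm I}\preceq WL_k^{\mathrm{II}}\preceq WL_{k/2+2}^{\mathrm{III}}\preceq WL_{k+5}^{\mathrm I}$. -/

import Mathlib

universe u v w

namespace GroupWL

/-! ### Colour refinement on `k`-tuples -/

/-- The colours used in round `i` of the refinement, when the initial colours lie in `C`: a colour of
round `i + 1` is a colour of round `i` together with a multiset of `k`-tuples of colours of round `i`. -/
def Color (k : ℕ) (C : Type w) : ℕ → Type w
  | 0 => C
  | i + 1 => Color k C i × Multiset (Fin k → Color k C i)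

/-- The colouring `χ_i` obtained from the initial colouring `χ₀` by `i` refinement rounds:
`χ_{i+1}(g) = (χ_i(g), {{ (χ_i(g[1 ← x]), …, χ_i(g[k ← x])) | x ∈ A }})`. -/
def refine {k : ℕ} {C : Type w} {A : Type u} [Fintype A] (χ₀ : (Fin k → A) → C) :
    (i : ℕ) → (Fin k → A) → Color k C i
  | 0, g => χ₀ g
  | i + 1, g =>
      (refine χ₀ i g,
        (Finset.univ : Finset A).val.map fun x j => refine χ₀ i (Function.update g j x))

/-- The colouring `χ_i` of all tuples of two structures `A` and `B` that are refined in parallel. -/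
def jointColoring {k : ℕ} {C : Type w} {A : Type u} {B : Type v} [Fintype A] [Fintype B]
    (χA : (Fin k → A) → C) (χB : (Fin k → B) → C) (i : ℕ) :
    (Fin k → A) ⊕ (Fin k → B) → Color k C i :=
  Sum.elim (refine χA i) (refine χB i)

/-- The first round `i` such that `χ_i` and `χ_{i+1}` induce the same partition of the tuples of the
two structures. -/
noncomputable def finalRound {k : ℕ} {C : Type w} {A : Type u} {B : Type v} [Fintype A] [Fintype B]
    (χA : (Fin k → A) → C) (χB : (Fin k → B) → C) : ℕ :=
  sInf {i | ∀ s t, jointColoring χA χB i s = jointColoring χA χB i t ↔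
    jointColoring χA χB (i + 1) s = jointColoring χA χB (i + 1) t}

/-- A tuple of `A` and a tuple of `B` have the same final colour. -/
def SameFinalColor {k : ℕ} {C : Type w} {A : Type u} {B : Type v} [Fintype A] [Fintype B]
    (χA : (Fin k → A) → C) (χB : (Fin k → B) → C) (g : Fin k → A) (h : Fin k → B) : Prop :=
  refine χA (finalRound χA χB) g = refine χB (finalRound χA χB) h

/-! ### Version I: equalities and products inside the tuple -/

/-- The initial colour of Version I: which entries are equal, and which products of two entries are
which entries. -/
def initI {k : ℕ} {G : Type u} [Group G] (g : Fin k → G) :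
    (Fin k → Fin k → Prop) × (Fin k → Fin k → Fin k → Prop) :=
  (fun i j => g i = g j, fun i j m => g i * g j = g m)

/-! ### Version II: marked isomorphism type -/

/-- A group together with a `k`-tuple of its elements. -/
structure GroupTuple (k : ℕ) where
  carrier : Type u
  [group : Group carrier]
  tuple : Fin k → carrier

attribute [instance] GroupTuple.group

/-- The map `g_i ↦ h_i` extends to an isomorphism `⟨g_1, …, g_k⟩ ≅ ⟨h_1, …, h_k⟩`. -/
def MarkedGroupIso {k : ℕ} {G : Type u} {H : Type v} [Group G] [Group H]
    (g : Fin k → G) (h : Fin k → H) : Prop :=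
  ∃ φ : Subgroup.closure (Set.range g) ≃* Subgroup.closure (Set.range h),
    ∀ i, φ ⟨g i, Subgroup.subset_closure ⟨i, rfl⟩⟩ = ⟨h i, Subgroup.subset_closure ⟨i, rfl⟩⟩

/-- Marked isomorphism as an equivalence relation. -/
def groupTupleSetoid (k : ℕ) : Setoid (GroupTuple.{u} k) where
  r s t := MarkedGroupIso s.tuple t.tuple
  iseqv :=
    { refl := fun _ => ⟨MulEquiv.refl _, fun _ => rfl⟩
      symm := fun ⟨φ, hφ⟩ => ⟨φ.symm, fun i => by rw [← hφ i, MulEquiv.symm_apply_apply]⟩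
      trans := fun ⟨φ, hφ⟩ ⟨ψ, hψ⟩ =>
        ⟨φ.trans ψ, fun i => by rw [MulEquiv.trans_apply, hφ i, hψ i]⟩ }

/-- The initial colour of Version II: the marked isomorphism type of the tuple. -/
def initII {k : ℕ} {G : Type u} [Group G] (g : Fin k → G) : Quotient (groupTupleSetoid.{u} k) :=
  Quotient.mk _ ⟨G, g⟩

/-! ### The classical algorithm for graphs, and Version III -/

/-- A simple graph together with a `k`-tuple of its vertices. -/
structure GraphTuple (k : ℕ) where
  vertex : Type u
  graph : SimpleGraph vertex
  tuple : Fin k → vertex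

/-- The map `v_i ↦ w_i` is an isomorphism of the subgraphs induced by the two tuples. -/
def MarkedGraphIso {k : ℕ} {V : Type u} {W : Type v} (Γ : SimpleGraph V) (Δ : SimpleGraph W)
    (a : Fin k → V) (b : Fin k → W) : Prop :=
  ∃ φ : Γ.induce (Set.range a) ≃g Δ.induce (Set.range b), ∀ i, φ ⟨a i, i, rfl⟩ = ⟨b i, i, rfl⟩

/-- Marked isomorphism of induced subgraphs as an equivalence relation. -/
def graphTupleSetoid (k : ℕ) : Setoid (GraphTuple.{u} k) where
  r s t := MarkedGraphIso s.graph t.graph s.tuple t.tuple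
  iseqv :=
    { refl := fun _ => ⟨RelIso.refl _, fun _ => rfl⟩
      symm := fun ⟨φ, hφ⟩ => ⟨φ.symm, fun i => by rw [← hφ i, RelIso.symm_apply_apply]⟩
      trans := fun ⟨φ, hφ⟩ ⟨ψ, hψ⟩ =>
        ⟨φ.trans ψ, fun i => by rw [RelIso.trans_apply, hφ i, hψ i]⟩ }

/-- The initial colour in the `k`-dimensional Weisfeiler-Leman algorithm for graphs (`k ≥ 2`): the
isomorphism type of the subgraph induced by the tuple, with its vertices marked by their positions. -/
def initGraph {k : ℕ} {V : Type u} (Γ : SimpleGraph V) (a : Fin k → V) :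
    Quotient (graphTupleSetoid.{u} k) :=
  Quotient.mk _ ⟨V, Γ, a⟩

/-- The vertices of `Γ_G`: the elements of `G` and, for each pair `(g, h)`, the four further nodes of
the multiplication gadget `M(g, h)`. -/
inductive Vertex (G : Type u) : Type u
  | elem (g : G)
  | a (g h : G)
  | b (g h : G)
  | c (g h : G)
  | d (g h : G)
  deriving Fintype

/-- The edges of the multiplication gadgets `M(g, h)`, each in one direction. -/
inductive GadgetEdge {G : Type u} [Group G] : Vertex G → Vertex G → Prop
  | left (g h : G) : GadgetEdge (.elem g) (.a g h)
  | right (g h : G) : GadgetEdge (.elem h) (.b g h)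
  | prod (g h : G) : GadgetEdge (.elem (g * h)) (.d g h)
  | ab (g h : G) : GadgetEdge (.a g h) (.b g h)
  | bc (g h : G) : GadgetEdge (.b g h) (.c g h)
  | cd (g h : G) : GadgetEdge (.c g h) (.d g h)

/-- The graph `Γ_G`. -/
def gadgetGraph (G : Type u) [Group G] : SimpleGraph (Vertex G) :=
  SimpleGraph.fromRel GadgetEdge

/-! ### Equivalence and comparison of the versions -/

/-- The three versions of the Weisfeiler-Leman algorithm for groups. -/
inductive Version
  | I
  | II
  | III

/-- `G ≡ H` with respect to the `k`-dimensional algorithm in the given version: there is a bijection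
`G^k → H^k` that preserves final colours. In Version III the tuples of group elements are coloured by
the algorithm for graphs, run on all `k`-tuples of vertices of `Γ_G` and of `Γ_H`. -/
def WLEquiv (J : Version) (k : ℕ) (G H : Type u) [Group G] [Group H] [Fintype G] [Fintype H] : Prop :=
  match J with
  | .I => ∃ f : (Fin k → G) ≃ (Fin k → H), ∀ g,
      SameFinalColor (initI (k := k) (G := G)) (initI (k := k) (G := H)) g (f g)
  | .II => ∃ f : (Fin k → G) ≃ (Fin k → H), ∀ g,
      SameFinalColor (initII (k := k) (G := G)) (initII (k := k) (G := H)) g (f g)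
  | .III => ∃ f : (Fin k → G) ≃ (Fin k → H), ∀ g,
      SameFinalColor (initGraph (k := k) (gadgetGraph G)) (initGraph (k := k) (gadgetGraph H))
        (fun i => Vertex.elem (g i)) (fun i => Vertex.elem (f g i))

/-- `WL_k^J ⪯ WL_{k'}^{J'}`: finite groups that are equivalent with respect to `WL_{k'}^{J'}` are
equivalent with respect to `WL_k^J`. -/
def WLLe (J : Version) (k : ℕ) (J' : Version) (k' : ℕ) : Prop :=
  ∀ (G H : Type u) [Group G] [Group H] [Fintype G] [Fintype H],
    WLEquiv J' k' G H → WLEquiv J k G H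

end GroupWL

/-!
Tuples with the same final colour are those from which Duplicator wins the bijective pebble game, so
bounding one version by another means turning a strategy for the one game into a strategy for the
other.

* I by II: marked isomorphisms preserve equalities and products.
* III by I: a vertex of `Γ_G` is given by its shape and at most two group elements, so `2n` pebbles
  on group elements simulate `n` pebbles on vertices. One further pebble, kept on the first
  parameter of a new vertex, makes Duplicator answer that parameter consistently.
* II by III: in a nontrivial group, the group elements have degree at least `4` in `Γ_G`, the
  vertices `b_{gh}` have degree `3` and all other vertices degree at most `2`. Hence with three
  pebbles Duplicator has to respect the gadgets. A pebble on `b_{gh}` holds the two group elements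
  `g` and `h`, and two further pebbles suffice for replacing one of them. When the pebbles on such
  vertices stay fixed, the pairs of group elements that Duplicator always matches form a subgroup of
  `G × H`, which contains the pebbled pairs and restricts to the graph of a marked isomorphism.
-/

namespace GroupWL

/-! ### Colour refinement as a bijective pebble game -/

section Game

variable {ι κ : Type*} [DecidableEq ι] [DecidableEq κ] {A A' B B' : Type*}
  {R : (ι → A) → (ι → B) → Prop}

/-- A winning condition for Duplicator in the bijective pebble game, with the pebbles `ι` on `A` and
on `B`: from each pair of positions in `R` Duplicator has a bijection such that, wherever Spoiler
puts a pebble, the two positions stay in `R`. -/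
def BackForth (R : (ι → A) → (ι → B) → Prop) : Prop :=
  ∀ g h, R g h → ∃ f : A ≃ B, ∀ x j, R (Function.update g j x) (Function.update h j (f x))

theorem BackForth.restrict (hR : BackForth R) (e : κ ↪ ι) :
    BackForth (Relation.Map R (· ∘ e) (· ∘ e)) := by
  rintro _ _ ⟨g, h, hgh, rfl, rfl⟩
  obtain ⟨f, hf⟩ := hR g h hgh
  exact ⟨f, fun x j => ⟨_, _, hf x (e j), Function.update_comp_eq_of_injective _ e.injective _ _,
    Function.update_comp_eq_of_injective _ e.injective _ _⟩⟩

theorem BackForth.fix_left {R : (κ ⊕ ι → A) → (κ ⊕ ι → B) → Prop} (hR : BackForth R)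
    (a : κ → A) (b : κ → B) : BackForth fun u u' => R (Sum.elim a u) (Sum.elim b u') := by
  intro u u' huu'
  obtain ⟨f, hf⟩ := hR _ _ huu'
  exact ⟨f, fun x j => by simpa only [Sum.elim_update_right] using hf x (.inr j)⟩

theorem exists_equiv_of_mem_range_iff {a : A' → A} {b : B' → B} (ha : a.Injective)
    (hb : b.Injective) (F : A ≃ B) (hF : ∀ x, x ∈ Set.range a ↔ F x ∈ Set.range b) :
    ∃ f : A' ≃ B', ∀ x, F (a x) = b (f x) := by
  refine ⟨(Equiv.ofInjective a ha).trans
    ((F.subtypeEquiv hF).trans (Equiv.ofInjective b hb).symm), fun x => ?_⟩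
  simp only [Equiv.trans_apply, Equiv.apply_ofInjective_symm, Equiv.subtypeEquiv_apply,
    Equiv.ofInjective_apply]

theorem BackForth.exists_equiv {k : ℕ} {R : (Fin k → A) → (Fin k → B) → Prop} (hR : BackForth R)
    {g : Fin k → A} {h : Fin k → B} (hgh : R g h) :
    ∃ F : (Fin k → A) ≃ (Fin k → B), ∀ u, R u (F u) := by
  induction k with
  | zero => exact ⟨Equiv.ofUnique _ _, fun u => by convert hgh⟩
  | succ k ih =>
    obtain ⟨f, hf⟩ := hR g h hgh
    have hcons (x : A) : BackForth fun u u' => R (Fin.cons x u) (Fin.cons (f x) u') := by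
      intro u u' huu'
      obtain ⟨f', hf'⟩ := hR _ _ huu'
      exact ⟨f', fun y j => by simpa only [Fin.cons_update] using hf' y j.succ⟩
    have hstart (x : A) : R (Fin.cons x (Fin.tail g)) (Fin.cons (f x) (Fin.tail h)) := by
      have hx := hf x 0
      rwa [← Fin.cons_self_tail g, ← Fin.cons_self_tail h, Fin.update_cons_zero,
        Fin.update_cons_zero] at hx
    choose F hF using fun x => ih (hcons x) (hstart x)
    refine ⟨(Fin.consEquiv fun _ => A).symm.trans
      ((Equiv.prodShear f F).trans (Fin.consEquiv fun _ => B)), fun u => ?_⟩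
    rw [← Fin.cons_self_tail u]
    exact hF (u 0) (Fin.tail u)

end Game

section Refinement

variable {k : ℕ} {C : Type w} {A : Type u} {B : Type v} [Fintype A] [Fintype B]
  {χA : (Fin k → A) → C} {χB : (Fin k → B) → C}

theorem map_univ_eq_map_univ_iff {D : Type*} {p : A → D} {q : B → D} :
    (Finset.univ : Finset A).val.map p = (Finset.univ : Finset B).val.map q ↔
      ∃ f : A ≃ B, ∀ x, p x = q (f x) := by
  classical
  constructor
  · intro h
    have hfiber (c : D) : Nonempty ({x // p x = c} ≃ {y // q y = c}) := by
      refine ⟨Fintype.equivOfCardEq ?_⟩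
      have hcount := congrArg (Multiset.count c) h
      rw [Multiset.count_map, Multiset.count_map] at hcount
      rw [Fintype.card_subtype, Fintype.card_subtype]
      simpa only [eq_comm, Finset.card, Finset.filter_val] using hcount
    exact ⟨Equiv.ofFiberEquiv fun c => (hfiber c).some,
      fun x => (Equiv.ofFiberEquiv_map _ x).symm⟩
  · rintro ⟨f, hf⟩
    rw [funext hf, ← Multiset.map_univ_val_equiv f, Multiset.map_map, Function.comp_def]

theorem refine_succ_eq_iff {i : ℕ} {g : Fin k → A} {h : Fin k → B} :
    refine χA (i + 1) g = refine χB (i + 1) h ↔ refine χA i g = refine χB i h ∧ ∃ f : A ≃ B,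
      ∀ x j, refine χA i (Function.update g j x) = refine χB i (Function.update h j (f x)) := by
  simp only [refine, Color, Prod.mk.injEq, map_univ_eq_map_univ_iff, funext_iff]

theorem BackForth.sameFinalColor {R : (Fin k → A) → (Fin k → B) → Prop} (hR : BackForth R)
    (hχ : ∀ g h, R g h → χA g = χB h) {g : Fin k → A} {h : Fin k → B} (hgh : R g h) :
    SameFinalColor χA χB g h := by
  have hrefine (i : ℕ) : ∀ g h, R g h → refine χA i g = refine χB i h := by
    induction i with
    | zero => exact hχ
    | succ i ih =>
      intro g h hgh
      obtain ⟨f, hf⟩ := hR g h hgh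
      exact refine_succ_eq_iff.2 ⟨ih g h hgh, f, fun x j => ih _ _ (hf x j)⟩
  exact hrefine _ g h hgh

theorem jointColoring_of_succ {i : ℕ} {s t : (Fin k → A) ⊕ (Fin k → B)}
    (h : jointColoring χA χB (i + 1) s = jointColoring χA χB (i + 1) t) :
    jointColoring χA χB i s = jointColoring χA χB i t := by
  rcases s with s | s <;> rcases t with t | t <;> exact congrArg Prod.fst h

variable (χA χB) in
theorem exists_stable_round : ∃ i, ∀ s t, jointColoring χA χB i s = jointColoring χA χB i t ↔
    jointColoring χA χB (i + 1) s = jointColoring χA χB (i + 1) t := by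
  let separated : ℕ →o Set (((Fin k → A) ⊕ (Fin k → B)) × ((Fin k → A) ⊕ (Fin k → B))) :=
    ⟨fun i => {p | jointColoring χA χB i p.1 ≠ jointColoring χA χB i p.2},
      monotone_nat_of_le_succ fun i p hp h => hp (jointColoring_of_succ h)⟩
  obtain ⟨n, hn⟩ := WellFoundedGT.monotone_chain_condition separated
  exact ⟨n, fun s t => not_iff_not.1 (Set.ext_iff.1 (hn (n + 1) n.le_succ) (s, t))⟩

theorem SameFinalColor.refine_succ_eq {g : Fin k → A} {h : Fin k → B}
    (hgh : SameFinalColor χA χB g h) :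
    refine χA (finalRound χA χB + 1) g = refine χB (finalRound χA χB + 1) h :=
  (Nat.sInf_mem (exists_stable_round χA χB) (.inl g) (.inr h)).1 hgh

variable (χA χB) in
theorem backForth_sameFinalColor : BackForth (SameFinalColor χA χB) := fun _ _ hgh =>
  (refine_succ_eq_iff.1 hgh.refine_succ_eq).2

theorem SameFinalColor.initial_eq {g : Fin k → A} {h : Fin k → B}
    (hgh : SameFinalColor χA χB g h) : χA g = χB h := by
  have hround (i : ℕ) : refine χA i g = refine χB i h → χA g = χB h := by
    induction i with
    | zero => exact id
    | succ i ih => exact fun hi => ih (congrArg Prod.fst hi)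
  exact hround _ hgh

end Refinement

/-! ### Marked isomorphisms -/

section MarkedGroupIso

theorem initI_eq_iff {k : ℕ} {G : Type u} {H : Type v} [Group G] [Group H]
    {g : Fin k → G} {h : Fin k → H} :
    initI g = initI h ↔ (∀ i j, g i = g j ↔ h i = h j) ∧
      ∀ i j m, g i * g j = g m ↔ h i * h j = h m := by
  simp [initI, Prod.ext_iff, funext_iff]

theorem initII_eq_iff {k : ℕ} {G H : Type u} [Group G] [Group H] {g : Fin k → G} {h : Fin k → H} :
    initII g = initII h ↔ MarkedGroupIso g h :=
  Quotient.eq (r := groupTupleSetoid k)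

variable {k : ℕ} {G : Type u} {H : Type v} [Group G] [Group H] {g : Fin k → G} {h : Fin k → H}

theorem MarkedGroupIso.initI_eq (hgh : MarkedGroupIso g h) : initI g = initI h := by
  obtain ⟨φ, hφ⟩ := hgh
  have hg (i : Fin k) : g i ∈ Subgroup.closure (Set.range g) := Subgroup.subset_closure ⟨i, rfl⟩
  have hφ' (i : Fin k) : (φ ⟨g i, hg i⟩ : H) = h i := congrArg Subtype.val (hφ i)
  refine initI_eq_iff.2 ⟨fun i j => ?_, fun i j m => ?_⟩
  · simpa only [Subtype.ext_iff, hφ'] using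
      (φ.apply_eq_iff_eq (x := ⟨g i, hg i⟩) (y := ⟨g j, hg j⟩)).symm
  · simpa only [Subtype.ext_iff, map_mul, Subgroup.coe_mul, hφ'] using
      (φ.apply_eq_iff_eq (x := ⟨g i, hg i⟩ * ⟨g j, hg j⟩) (y := ⟨g m, hg m⟩)).symm

theorem markedGroupIso_of_subgroup (M : Subgroup (G × H)) (hM : ∀ p ∈ M, p.1 = 1 ↔ p.2 = 1)
    (hgh : ∀ i, (g i, h i) ∈ M) : MarkedGroupIso g h := by
  let L : Subgroup (G × H) := Subgroup.closure (Set.range fun i => (g i, h i))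
  have hL (p : L) : p.1.1 = 1 ↔ p.1.2 = 1 :=
    hM p.1 ((Subgroup.closure_le M).2 (Set.range_subset_iff.2 hgh) p.2)
  let fstL : L →* G := (MonoidHom.fst G H).comp L.subtype
  let sndL : L →* H := (MonoidHom.snd G H).comp L.subtype
  have fst_injective : Function.Injective fstL :=
    (injective_iff_map_eq_one fstL).2 fun p hp => Subtype.ext (Prod.ext hp ((hL p).1 hp))
  have snd_injective : Function.Injective sndL :=
    (injective_iff_map_eq_one sndL).2 fun p hp => Subtype.ext (Prod.ext ((hL p).2 hp) hp)
  have range_fst : fstL.range = Subgroup.closure (Set.range g) := by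
    rw [MonoidHom.range_comp, Subgroup.range_subtype, MonoidHom.map_closure, ← Set.range_comp]
    rfl
  have range_snd : sndL.range = Subgroup.closure (Set.range h) := by
    rw [MonoidHom.range_comp, Subgroup.range_subtype, MonoidHom.map_closure, ← Set.range_comp]
    rfl
  let φ : L ≃* Subgroup.closure (Set.range g) :=
    (MonoidHom.ofInjective fst_injective).trans (MulEquiv.subgroupCongr range_fst)
  let ψ : L ≃* Subgroup.closure (Set.range h) :=
    (MonoidHom.ofInjective snd_injective).trans (MulEquiv.subgroupCongr range_snd)
  refine ⟨φ.symm.trans ψ, fun i => ?_⟩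
  have hφ : φ.symm ⟨g i, Subgroup.subset_closure ⟨i, rfl⟩⟩ =
      ⟨(g i, h i), Subgroup.subset_closure ⟨i, rfl⟩⟩ := φ.symm_apply_eq.2 (Subtype.ext rfl)
  rw [MulEquiv.trans_apply, hφ]
  exact Subtype.ext rfl

theorem wlLe_I_II (k : ℕ) : WLLe.{u} .I k .II k := by
  rintro G H _ _ _ _ ⟨f, hf⟩
  exact ⟨f, fun g => (backForth_sameFinalColor initII initII).sameFinalColor
    (fun _ _ hgh => (initII_eq_iff.1 hgh.initial_eq).initI_eq) (hf g)⟩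

end MarkedGroupIso

section MarkedGraphIso

theorem initGraph_eq_iff {k : ℕ} {V W : Type u} {Γ : SimpleGraph V} {Δ : SimpleGraph W}
    {a : Fin k → V} {b : Fin k → W} :
    initGraph Γ a = initGraph Δ b ↔ MarkedGraphIso Γ Δ a b :=
  Quotient.eq (r := graphTupleSetoid k)

theorem markedGraphIso_iff {k : ℕ} {V : Type u} {W : Type v} {Γ : SimpleGraph V}
    {Δ : SimpleGraph W} {a : Fin k → V} {b : Fin k → W} :
    MarkedGraphIso Γ Δ a b ↔ (∀ i j, a i = a j ↔ b i = b j) ∧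
      ∀ i j, Γ.Adj (a i) (a j) ↔ Δ.Adj (b i) (b j) := by
  constructor
  · rintro ⟨φ, hφ⟩
    have hφ' (i : Fin k) : (φ ⟨a i, i, rfl⟩ : W) = b i := congrArg Subtype.val (hφ i)
    constructor <;> intro i j
    · simpa only [Subtype.ext_iff, hφ'] using
        (φ.injective.eq_iff (a := ⟨a i, i, rfl⟩) (b := ⟨a j, j, rfl⟩)).symm
    · simpa only [SimpleGraph.comap_adj, Function.Embedding.subtype_apply, hφ'] using
        (φ.map_rel_iff (a := ⟨a i, i, rfl⟩) (b := ⟨a j, j, rfl⟩)).symm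
  · rintro ⟨heq, hadj⟩
    choose p hp using fun x : Set.range a => x.2
    choose q hq using fun y : Set.range b => y.2
    have hpb (i : Fin k) : b (p ⟨a i, i, rfl⟩) = b i := (heq _ _).1 (hp ⟨a i, i, rfl⟩)
    have hqa (i : Fin k) : a (q ⟨b i, i, rfl⟩) = a i := (heq _ _).2 (hq ⟨b i, i, rfl⟩)
    refine ⟨⟨⟨fun x => ⟨b (p x), p x, rfl⟩, fun y => ⟨a (q y), q y, rfl⟩, fun x => ?_, fun y => ?_⟩,
      fun {x y} => ?_⟩, fun i => Subtype.ext (hpb i)⟩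
    · exact Subtype.ext ((hqa _).trans (hp x))
    · exact Subtype.ext ((hpb _).trans (hq y))
    · change Δ.Adj (b (p x)) (b (p y)) ↔ Γ.Adj x.1 y.1
      rw [← hadj, hp, hp]

end MarkedGraphIso

section Strategy

variable {ι κ : Type*} [DecidableEq ι] [DecidableEq κ]

/-- `R` is a winning condition for Duplicator in the pebble game of Version I: related tuples
satisfy the same equalities and the same products. -/
structure GroupStrategy {G H : Type*} [Group G] [Group H] (R : (ι → G) → (ι → H) → Prop) :
    Prop where
  backForth : BackForth R
  eq_iff : ∀ {g h}, R g h → ∀ i j, g i = g j ↔ h i = h j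
  mul_iff : ∀ {g h}, R g h → ∀ i j m, g i * g j = g m ↔ h i * h j = h m

/-- `R` is a winning condition for Duplicator in the pebble game on two graphs: related tuples
satisfy the same equalities and adjacencies. -/
structure GraphStrategy {V W : Type*} (Γ : SimpleGraph V) (Δ : SimpleGraph W)
    (R : (ι → V) → (ι → W) → Prop) : Prop where
  backForth : BackForth R
  eq_iff : ∀ {v w}, R v w → ∀ i j, v i = v j ↔ w i = w j
  adj_iff : ∀ {v w}, R v w → ∀ i j, Γ.Adj (v i) (v j) ↔ Δ.Adj (w i) (w j)

theorem groupStrategy_sameFinalColor {k : ℕ} (G : Type u) (H : Type v) [Group G] [Group H]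
    [Fintype G] [Fintype H] :
    GroupStrategy (SameFinalColor (initI (k := k) (G := G)) (initI (G := H))) where
  backForth := backForth_sameFinalColor initI initI
  eq_iff h := (initI_eq_iff.1 h.initial_eq).1
  mul_iff h := (initI_eq_iff.1 h.initial_eq).2

theorem graphStrategy_sameFinalColor {k : ℕ} {V W : Type u} [Fintype V] [Fintype W]
    (Γ : SimpleGraph V) (Δ : SimpleGraph W) :
    GraphStrategy Γ Δ (SameFinalColor (initGraph (k := k) Γ) (initGraph Δ)) where
  backForth := backForth_sameFinalColor (initGraph Γ) (initGraph Δ)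
  eq_iff h := (markedGraphIso_iff.1 (initGraph_eq_iff.1 h.initial_eq)).1
  adj_iff h := (markedGraphIso_iff.1 (initGraph_eq_iff.1 h.initial_eq)).2

theorem GraphStrategy.sameFinalColor {k : ℕ} {V W : Type u} [Fintype V] [Fintype W]
    {Γ : SimpleGraph V} {Δ : SimpleGraph W} {R : (Fin k → V) → (Fin k → W) → Prop}
    (hR : GraphStrategy Γ Δ R) {v : Fin k → V} {w : Fin k → W} (hvw : R v w) :
    SameFinalColor (initGraph Γ) (initGraph Δ) v w :=
  hR.backForth.sameFinalColor (fun _ _ h => initGraph_eq_iff.2 <|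
    markedGraphIso_iff.2 ⟨hR.eq_iff h, hR.adj_iff h⟩) hvw

theorem GroupStrategy.restrict {G H : Type*} [Group G] [Group H] {R : (ι → G) → (ι → H) → Prop}
    (hR : GroupStrategy R) (e : κ ↪ ι) : GroupStrategy (Relation.Map R (· ∘ e) (· ∘ e)) where
  backForth := hR.backForth.restrict e
  eq_iff := by
    rintro _ _ ⟨g, h, hgh, rfl, rfl⟩ i j
    exact hR.eq_iff hgh (e i) (e j)
  mul_iff := by
    rintro _ _ ⟨g, h, hgh, rfl, rfl⟩ i j m
    exact hR.mul_iff hgh (e i) (e j) (e m)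

theorem GraphStrategy.restrict {V W : Type*} {Γ : SimpleGraph V} {Δ : SimpleGraph W}
    {R : (ι → V) → (ι → W) → Prop} (hR : GraphStrategy Γ Δ R) (e : κ ↪ ι) :
    GraphStrategy Γ Δ (Relation.Map R (· ∘ e) (· ∘ e)) where
  backForth := hR.backForth.restrict e
  eq_iff := by
    rintro _ _ ⟨v, w, hvw, rfl, rfl⟩ i j
    exact hR.eq_iff hvw (e i) (e j)
  adj_iff := by
    rintro _ _ ⟨v, w, hvw, rfl, rfl⟩ i j
    exact hR.adj_iff hvw (e i) (e j)

end Strategy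

/-! ### Version III is bounded by Version I -/

namespace Vertex

variable {G : Type u} [Group G]

/-- The edges of the gadgets, each in one direction, computed from the shapes of the end points. -/
def Edge : Vertex G → Vertex G → Prop
  | elem x, a g _ => x = g
  | elem x, b _ h => x = h
  | elem x, d g h => g * h = x
  | a g h, b g' h' => g = g' ∧ h = h'
  | b g h, c g' h' => g = g' ∧ h = h'
  | c g h, d g' h' => g = g' ∧ h = h'
  | _, _ => False

theorem gadgetEdge_iff {v w : Vertex G} : GadgetEdge v w ↔ v.Edge w := by
  constructor
  · rintro (_ | _ | _ | _ | _ | _) <;> simp [Edge]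
  · cases v <;> cases w <;> simp only [Edge, false_imp_iff] <;>
      first
        | (rintro rfl; constructor)
        | (rintro ⟨rfl, rfl⟩; constructor)

theorem gadgetGraph_adj {v w : Vertex G} : (gadgetGraph G).Adj v w ↔ v.Edge w ∨ w.Edge v := by
  rw [gadgetGraph, SimpleGraph.fromRel_adj, gadgetEdge_iff, gadgetEdge_iff, and_iff_right_iff_imp]
  rintro h rfl
  cases v <;> simp [Edge] at h

end Vertex

namespace Vertex

variable {G H : Type*}

/-- `v` and `w` are vertices of the same shape, `v` with the parameters `x` and `w` with the
parameters `y`. A group element has the single parameter `x false`. -/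
inductive Coded (x : Bool → G) (y : Bool → H) : Vertex G → Vertex H → Prop
  | elem : Coded x y (.elem (x false)) (.elem (y false))
  | a : Coded x y (.a (x false) (x true)) (.a (y false) (y true))
  | b : Coded x y (.b (x false) (x true)) (.b (y false) (y true))
  | c : Coded x y (.c (x false) (x true)) (.c (y false) (y true))
  | d : Coded x y (.d (x false) (x true)) (.d (y false) (y true))

theorem Coded.eq_iff {x x' : Bool → G} {y y' : Bool → H} (heq : ∀ s t, x s = x' t ↔ y s = y' t)
    {v v' : Vertex G} {w w' : Vertex H} (h : Coded x y v w) (h' : Coded x' y' v' w') :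
    v = v' ↔ w = w' := by
  cases h <;> cases h' <;> simp [heq]

theorem Coded.edge_iff [Group G] [Group H] {x x' : Bool → G} {y y' : Bool → H}
    (heq : ∀ s t, x s = x' t ↔ y s = y' t)
    (hmul : x' false * x' true = x false ↔ y' false * y' true = y false)
    {v v' : Vertex G} {w w' : Vertex H} (h : Coded x y v w) (h' : Coded x' y' v' w') :
    v.Edge v' ↔ w.Edge w' := by
  cases h <;> cases h' <;> simp [Edge, heq, hmul]

/-- The bijection of vertices that applies `f` to the first parameter of a vertex and `f₂ x`, where
`x` is the first parameter, to the second one. -/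
def equivOfShear (f : G ≃ H) (f₂ : G → (G ≃ H)) : Vertex G ≃ Vertex H where
  toFun
    | elem x => elem (f x)
    | a x y => a (f x) (f₂ x y)
    | b x y => b (f x) (f₂ x y)
    | c x y => c (f x) (f₂ x y)
    | d x y => d (f x) (f₂ x y)
  invFun
    | elem x => elem (f.symm x)
    | a x y => a (f.symm x) ((f₂ (f.symm x)).symm y)
    | b x y => b (f.symm x) ((f₂ (f.symm x)).symm y)
    | c x y => c (f.symm x) ((f₂ (f.symm x)).symm y)
    | d x y => d (f.symm x) ((f₂ (f.symm x)).symm y)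
  left_inv v := by cases v <;> simp
  right_inv v := by cases v <;> simp

theorem exists_coded_equivOfShear (f : G ≃ H) (f₂ : G → (G ≃ H)) (v : Vertex G) :
    ∃ x y, Coded (fun s => cond s y x) (fun s => cond s (f₂ x y) (f x)) v
      (equivOfShear f f₂ v) := by
  cases v with
  | elem x => exact ⟨x, x, .elem⟩
  | a x y => exact ⟨x, y, .a⟩
  | b x y => exact ⟨x, y, .b⟩
  | c x y => exact ⟨x, y, .c⟩
  | d x y => exact ⟨x, y, .d⟩

end Vertex

section CodedRel

open Function Vertex

variable {ι : Type*} [DecidableEq ι] {G H : Type*} [Group G] [Group H]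

theorem GroupStrategy.exists_shear {R : (ι → G) → (ι → H) → Prop} (hR : GroupStrategy R)
    {g : ι → G} {h : ι → H} (hgh : R g h) (p : ι) :
    ∃ (f : G ≃ H) (f₂ : G → (G ≃ H)), ∀ x y i j, i ≠ p → j ≠ p →
      R (update (update (update g p x) j y) i x)
        (update (update (update h p (f x)) j (f₂ x y)) i (f x)) := by
  obtain ⟨f, hf⟩ := hR.backForth g h hgh
  choose f₂ hf₂ using fun x => hR.backForth _ _ (hf x p)
  refine ⟨f, f₂, fun x y i j hip hjp => ?_⟩
  obtain ⟨f₃, hf₃⟩ := hR.backForth _ _ (hf₂ x y j)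
  -- The pebble at `p` makes Duplicator answer the second `x` as the first one.
  have hx : f₃ x = f x := by
    simpa [hip.symm, hjp.symm] using hR.eq_iff (hf₃ x i) i p
  simpa only [hx] using hf₃ x i

/-- The tuples of vertices `v`, `w` are coded by tuples in `R`, the two parameters of the `i`-th
vertex being the entries at `some (i, false)` and `some (i, true)`. The spare entry at `none` is
used by Duplicator to answer both parameters of a vertex consistently. -/
def CodedRel (R : (Option (ι × Bool) → G) → (Option (ι × Bool) → H) → Prop)
    (v : ι → Vertex G) (w : ι → Vertex H) : Prop :=
  ∃ g h, R g h ∧ ∀ i, Coded (fun s => g (some (i, s))) (fun s => h (some (i, s))) (v i) (w i)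

variable {R : (Option (ι × Bool) → G) → (Option (ι × Bool) → H) → Prop}

theorem GroupStrategy.exists_equivOfShear (hR : GroupStrategy R)
    {v : ι → Vertex G} {w : ι → Vertex H} (hvw : CodedRel R v w) :
    ∃ (f : G ≃ H) (f₂ : G → (G ≃ H)), ∀ u j,
      CodedRel R (update v j u) (update w j (equivOfShear f f₂ u)) := by
  obtain ⟨g, h, hgh, hcoded⟩ := hvw
  obtain ⟨f, f₂, hf⟩ := hR.exists_shear hgh none
  refine ⟨f, f₂, fun u j => ?_⟩
  obtain ⟨x, y, hu⟩ := exists_coded_equivOfShear f f₂ u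
  refine ⟨_, _, hf x y (some (j, false)) (some (j, true)) (by simp) (by simp),
    fun i => ?_⟩
  obtain rfl | hij := eq_or_ne i j
  · convert hu using 1
    · exact funext fun s => by cases s <;> simp
    · exact funext fun s => by cases s <;> simp
    · exact update_self ..
    · exact update_self ..
  · simpa [hij] using hcoded i

theorem GroupStrategy.graphStrategy_codedRel (hR : GroupStrategy R) :
    GraphStrategy (gadgetGraph G) (gadgetGraph H) (CodedRel R) where
  backForth v w hvw := by
    obtain ⟨f, f₂, hf⟩ := hR.exists_equivOfShear hvw
    exact ⟨equivOfShear f f₂, hf⟩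
  eq_iff := by
    rintro v w ⟨g, h, hgh, hcoded⟩ i j
    exact (hcoded i).eq_iff (fun s t => hR.eq_iff hgh _ _) (hcoded j)
  adj_iff := by
    rintro v w ⟨g, h, hgh, hcoded⟩ i j
    have hedge (i j : ι) : (v i).Edge (v j) ↔ (w i).Edge (w j) :=
      (hcoded i).edge_iff (fun s t => hR.eq_iff hgh _ _) (hR.mul_iff hgh _ _ _) (hcoded j)
    rw [gadgetGraph_adj, gadgetGraph_adj, hedge i j, hedge j i]

theorem GroupStrategy.backForth_codedRel_elem (hR : GroupStrategy R) :
    BackForth fun (g : ι → G) (h : ι → H) => CodedRel R (elem ∘ g) (elem ∘ h) := by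
  intro g h hgh
  obtain ⟨f, _, hf⟩ := hR.exists_equivOfShear hgh
  refine ⟨f, fun x j => ?_⟩
  change CodedRel R (elem ∘ update g j x) (elem ∘ update h j (f x))
  rw [comp_update, comp_update]
  exact hf (elem x) j

theorem wlLe_III_I {n K : ℕ} (hK : 2 * n + 1 ≤ K) : WLLe.{u} .III n .I K := by
  rintro G H _ _ _ _ ⟨F, hF⟩
  obtain ⟨e⟩ : Nonempty (Option (Fin n × Bool) ↪ Fin K) :=
    Embedding.nonempty_of_card_le (by simpa [mul_comm n 2] using hK)
  have hR := (groupStrategy_sameFinalColor G H).restrict e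
  obtain ⟨E, hE⟩ := hR.backForth_codedRel_elem.exists_equiv
    ⟨_, _, ⟨1, F 1, hF 1, rfl, rfl⟩, fun i => .elem⟩
  exact ⟨E, fun g => hR.graphStrategy_codedRel.sameFinalColor (hE g)⟩

end CodedRel

section Preserved

open Function

variable {ι : Type*} {A B : Type*} {R : (ι → A) → (ι → B) → Prop} {P P' : A → Prop}
  {Q Q' : B → Prop} {S S' : A → A → Prop} {T T' : B → B → Prop}

/-- Tuples related by `R` agree on the properties `P` and `Q` at every position. -/
def Preserves₁ (R : (ι → A) → (ι → B) → Prop) (P : A → Prop) (Q : B → Prop) : Prop :=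
  ∀ ⦃g h⦄, R g h → ∀ i, P (g i) ↔ Q (h i)

/-- Tuples related by `R` agree on the relations `S` and `T` at any two different positions. -/
def Preserves₂ (R : (ι → A) → (ι → B) → Prop) (S : A → A → Prop) (T : B → B → Prop) : Prop :=
  ∀ ⦃g h⦄, R g h → ∀ ⦃i j⦄, i ≠ j → (S (g i) (g j) ↔ T (h i) (h j))

theorem Preserves₁.not (h : Preserves₁ R P Q) : Preserves₁ R (fun x => ¬ P x) (fun y => ¬ Q y) :=
  fun _ _ hgh i => not_congr (h hgh i)

theorem Preserves₁.and (h : Preserves₁ R P Q) (h' : Preserves₁ R P' Q') :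
    Preserves₁ R (fun x => P x ∧ P' x) (fun y => Q y ∧ Q' y) :=
  fun _ _ hgh i => and_congr (h hgh i) (h' hgh i)

theorem Preserves₁.left (h : Preserves₁ R P Q) : Preserves₂ R (fun x _ => P x) (fun y _ => Q y) :=
  fun _ _ hgh i _ _ => h hgh i

theorem Preserves₂.swap (h : Preserves₂ R S T) : Preserves₂ R (Function.swap S) (Function.swap T) :=
  fun _ _ hgh _ _ hij => h hgh hij.symm

theorem Preserves₁.right (h : Preserves₁ R P Q) :
    Preserves₂ R (fun _ x => P x) (fun _ y => Q y) :=
  h.left.swap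

theorem Preserves₂.and (h : Preserves₂ R S T) (h' : Preserves₂ R S' T') :
    Preserves₂ R (fun x x' => S x x' ∧ S' x x') (fun y y' => T y y' ∧ T' y y') :=
  fun _ _ hgh _ _ hij => and_congr (h hgh hij) (h' hgh hij)

variable [DecidableEq ι]

theorem Preserves₂.comp (h : Preserves₂ R S T) (h' : Preserves₂ R S' T') (hR : BackForth R)
    (hι : 3 ≤ ENat.card ι) : Preserves₂ R (Relation.Comp S S') (Relation.Comp T T') := by
  intro g g' hgg' i j _
  obtain ⟨r, hri, hrj⟩ := ENat.exists_ne_ne_of_three_le hι i j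
  obtain ⟨f, hf⟩ := hR g g' hgg'
  refine f.exists_congr fun z => and_congr ?_ ?_
  · simpa only [update_self, update_of_ne hri.symm] using h (hf z r) hri.symm
  · simpa only [update_self, update_of_ne hrj.symm] using h' (hf z r) hrj

theorem Preserves₂.exists [Nontrivial ι] (h : Preserves₂ R S T) (hR : BackForth R) :
    Preserves₁ R (fun x => ∃ z, S x z) (fun y => ∃ z, T y z) := by
  intro g g' hgg' i
  obtain ⟨r, hri⟩ := exists_ne i
  obtain ⟨f, hf⟩ := hR g g' hgg'
  refine f.exists_congr fun z => ?_
  simpa only [update_self, update_of_ne hri.symm] using h (hf z r) hri.symm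

theorem Preserves₂.of_preserves_eq [Nontrivial ι] {x : A} {y : B} (h : Preserves₂ R S T)
    (hxy : Preserves₁ R (· = x) (· = y)) (hR : BackForth R) : Preserves₁ R (S x) (T y) := by
  simpa only [Function.swap, exists_eq_right] using (h.swap.and hxy.right).exists hR

theorem BackForth.exists_equiv_range [Nonempty ι] {A' B' : Type*} {a : A' → A} {b : B' → B}
    (hR : BackForth R) (ha : a.Injective) (hb : b.Injective)
    (hab : Preserves₁ R (· ∈ Set.range a) (· ∈ Set.range b)) {g : ι → A} {h : ι → B}
    (hgh : R g h) : ∃ f : A' ≃ B', ∀ x j, R (update g j (a x)) (update h j (b (f x))) := by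
  obtain ⟨F, hF⟩ := hR g h hgh
  inhabit ι
  obtain ⟨f, hf⟩ := exists_equiv_of_mem_range_iff ha hb F fun x => by
    simpa only [update_self] using hab (hF x default) default
  exact ⟨f, fun x j => by simpa only [hf] using hF (a x) j⟩

variable {Γ : SimpleGraph A} {Δ : SimpleGraph B}

theorem GraphStrategy.preserves_adj (hR : GraphStrategy Γ Δ R) : Preserves₂ R Γ.Adj Δ.Adj :=
  fun _ _ hvw i j _ => hR.adj_iff hvw i j

theorem GraphStrategy.encard_neighborSet [Nontrivial ι] (hR : GraphStrategy Γ Δ R)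
    {v : ι → A} {w : ι → B} (hvw : R v w) (i : ι) :
    (Γ.neighborSet (v i)).encard = (Δ.neighborSet (w i)).encard := by
  obtain ⟨r, hri⟩ := exists_ne i
  obtain ⟨f, hf⟩ := hR.backForth v w hvw
  have hadj (x : A) : Γ.Adj (v i) x ↔ Δ.Adj (w i) (f x) := by
    simpa only [update_self, update_of_ne hri.symm] using hR.adj_iff (hf x r) i r
  have himage : f '' Γ.neighborSet (v i) = Δ.neighborSet (w i) := by
    ext y
    rw [f.image_eq_preimage_symm, Set.mem_preimage, SimpleGraph.mem_neighborSet, hadj,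
      f.apply_symm_apply, SimpleGraph.mem_neighborSet]
  rw [← himage, f.injective.encard_image]

theorem GraphStrategy.preserves_encard_neighborSet [Nontrivial ι] (hR : GraphStrategy Γ Δ R)
    (p : ℕ∞ → Prop) :
    Preserves₁ R (fun x => p (Γ.neighborSet x).encard) (fun y => p (Δ.neighborSet y).encard) :=
  fun _ _ hvw i => by simp only [hR.encard_neighborSet hvw i]

end Preserved

/-! ### Recovering the gadgets from the graph -/

namespace Vertex

variable {G : Type*}

/-- The middle vertex of the gadget of `(x false, x true)`, which represents this pair. The vertices
`c` would not do: in `Γ_G` they have the same degree as the vertices `a` and `d`. -/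
def pair (x : Bool → G) : Vertex G := b (x false) (x true)

/-- The vertex lies on a gadget, but is neither a group element nor the middle vertex. -/
def IsMinor (v : Vertex G) : Prop := v ∉ Set.range elem ∧ v ∉ Set.range pair

/-- `z` is the first (`s = false`) or second (`s = true`) element of the pair `v`. -/
def IsSide (s : Bool) (z v : Vertex G) : Prop := ∃ x, z = elem (x s) ∧ v = pair x

/-- `z` is the product of the two elements of the pair `v`. -/
def IsProd [Group G] (z v : Vertex G) : Prop := ∃ x, z = elem (x false * x true) ∧ v = pair x

theorem elem_injective : Function.Injective (elem : G → Vertex G) := fun _ _ => elem.inj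

theorem pair_injective : Function.Injective (pair : (Bool → G) → Vertex G) := fun x y h =>
  funext fun s => by cases s; exacts [(b.inj h).1, (b.inj h).2]

theorem b_mem_range_pair (x y : G) : b x y ∈ Set.range pair := ⟨fun s => cond s y x, rfl⟩

theorem isMinor_iff {v : Vertex G} :
    v.IsMinor ↔ ∃ x y, v = a x y ∨ v = c x y ∨ v = d x y := by
  constructor
  · rintro ⟨helem, hpair⟩
    cases v with
    | elem x => exact absurd ⟨x, rfl⟩ helem
    | b x y => exact absurd (b_mem_range_pair x y) hpair
    | a x y => exact ⟨x, y, .inl rfl⟩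
    | c x y => exact ⟨x, y, .inr (.inl rfl)⟩
    | d x y => exact ⟨x, y, .inr (.inr rfl)⟩
  · rintro ⟨x, y, rfl | rfl | rfl⟩ <;> constructor <;> rintro ⟨_, ⟨⟩⟩

@[simp]
theorem isSide_pair {s : Bool} {z : Vertex G} {x : Bool → G} :
    IsSide s z (pair x) ↔ z = elem (x s) := by
  simp only [IsSide, pair_injective.eq_iff, exists_eq_right']

variable [Group G]

@[simp]
theorem isProd_pair {z : Vertex G} {x : Bool → G} :
    IsProd z (pair x) ↔ z = elem (x false * x true) := by
  simp only [IsProd, pair_injective.eq_iff, exists_eq_right']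

theorem isSide_true_iff {z v : Vertex G} :
    IsSide true z v ↔ (gadgetGraph G).Adj z v ∧ z ∈ Set.range elem ∧ v ∈ Set.range pair := by
  constructor
  · rintro ⟨x, rfl, rfl⟩
    exact ⟨gadgetGraph_adj.2 (.inl rfl), ⟨_, rfl⟩, x, rfl⟩
  · rintro ⟨hadj, ⟨z, rfl⟩, ⟨x, rfl⟩⟩
    rw [isSide_pair]
    simpa [gadgetGraph_adj, pair, Edge] using hadj

theorem isSide_false_iff {z v : Vertex G} :
    IsSide false z v ↔
      Relation.Comp (fun z m => (gadgetGraph G).Adj z m ∧ m.IsMinor) (gadgetGraph G).Adj z v ∧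
        z ∈ Set.range elem ∧ v ∈ Set.range pair := by
  constructor
  · rintro ⟨x, rfl, rfl⟩
    exact ⟨⟨a (x false) (x true), ⟨gadgetGraph_adj.2 (.inl rfl), isMinor_iff.2 ⟨_, _, .inl rfl⟩⟩,
      gadgetGraph_adj.2 (.inl ⟨rfl, rfl⟩)⟩, ⟨_, rfl⟩, x, rfl⟩
  · rintro ⟨⟨m, ⟨hzm, hm⟩, hmv⟩, ⟨z, rfl⟩, ⟨x, rfl⟩⟩
    rw [isSide_pair]
    obtain ⟨g, h, rfl | rfl | rfl⟩ := isMinor_iff.1 hm <;>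
      simp_all [gadgetGraph_adj, pair, Edge]

theorem isProd_iff {z v : Vertex G} :
    IsProd z v ↔
      Relation.Comp (Relation.Comp (fun z l => (gadgetGraph G).Adj z l ∧ l.IsMinor)
          fun l m => (gadgetGraph G).Adj l m ∧ m.IsMinor) (gadgetGraph G).Adj z v ∧
        z ∈ Set.range elem ∧ v ∈ Set.range pair := by
  constructor
  · rintro ⟨x, rfl, rfl⟩
    exact ⟨⟨c (x false) (x true), ⟨d (x false) (x true),
      ⟨gadgetGraph_adj.2 (.inl rfl), isMinor_iff.2 ⟨_, _, .inr (.inr rfl)⟩⟩,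
      gadgetGraph_adj.2 (.inr ⟨rfl, rfl⟩), isMinor_iff.2 ⟨_, _, .inr (.inl rfl)⟩⟩,
      gadgetGraph_adj.2 (.inr ⟨rfl, rfl⟩)⟩, ⟨_, rfl⟩, x, rfl⟩
  · rintro ⟨⟨m, ⟨l, ⟨hzl, hl⟩, hlm, hm⟩, hmv⟩, ⟨z, rfl⟩, ⟨x, rfl⟩⟩
    rw [isProd_pair]
    obtain ⟨g, h, rfl | rfl | rfl⟩ := isMinor_iff.1 hl <;>
      obtain ⟨g', h', rfl | rfl | rfl⟩ := isMinor_iff.1 hm <;>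
        simp_all [gadgetGraph_adj, pair, Edge]

theorem four_le_encard_neighborSet_elem [Nontrivial G] (x : G) :
    4 ≤ ((gadgetGraph G).neighborSet (elem x)).encard := by
  obtain ⟨y, hy⟩ := exists_ne (1 : G)
  have hsub : ({a x 1, a x y, b 1 x, b y x} : Set (Vertex G)) ⊆
      (gadgetGraph G).neighborSet (elem x) := by
    rintro _ (rfl | rfl | rfl | rfl) <;> simp [gadgetGraph_adj, Edge]
  refine le_of_eq_of_le ?_ (Set.encard_le_encard hsub)
  rw [Set.encard_insert_of_notMem (by simp [hy.symm]), Set.encard_insert_of_notMem (by simp),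
    Set.encard_pair (by simp [hy.symm])]
  norm_num

theorem encard_neighborSet_pair (x : Bool → G) :
    ((gadgetGraph G).neighborSet (pair x)).encard = 3 := by
  have hset : (gadgetGraph G).neighborSet (pair x) =
      {elem (x true), a (x false) (x true), c (x false) (x true)} := by
    ext v
    cases v <;> simp [gadgetGraph_adj, pair, Edge, eq_comm]
  rw [hset, Set.encard_insert_of_notMem (by simp), Set.encard_pair (by simp)]
  norm_num

theorem IsMinor.encard_neighborSet_le {v : Vertex G} (hv : v.IsMinor) :
    ((gadgetGraph G).neighborSet v).encard ≤ 2 := by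
  obtain ⟨l, m, hsub⟩ : ∃ l m, (gadgetGraph G).neighborSet v ⊆ {l, m} := by
    obtain ⟨x, y, rfl | rfl | rfl⟩ := isMinor_iff.1 hv
    · refine ⟨elem x, b x y, fun w hw => ?_⟩
      cases w <;> simp_all [gadgetGraph_adj, Edge]
    · refine ⟨b x y, d x y, fun w hw => ?_⟩
      cases w <;> simp_all [gadgetGraph_adj, Edge]
    · refine ⟨elem (x * y), c x y, fun w hw => ?_⟩
      cases w <;> simp_all [gadgetGraph_adj, Edge]
  calc ((gadgetGraph G).neighborSet v).encard
      ≤ ({l, m} : Set (Vertex G)).encard := Set.encard_le_encard hsub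
    _ ≤ ({m} : Set (Vertex G)).encard + 1 := Set.encard_insert_le _ _
    _ = 2 := by rw [Set.encard_singleton, one_add_one_eq_two]

theorem mem_range_elem_iff [Nontrivial G] {v : Vertex G} :
    v ∈ Set.range elem ↔ 4 ≤ ((gadgetGraph G).neighborSet v).encard := by
  constructor
  · rintro ⟨x, rfl⟩
    exact four_le_encard_neighborSet_elem x
  · refine fun hdeg => by_contra fun helem => ?_
    by_cases hpair : v ∈ Set.range pair
    · obtain ⟨x, rfl⟩ := hpair
      rw [encard_neighborSet_pair] at hdeg
      exact absurd hdeg (by decide)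
    · exact absurd (hdeg.trans (IsMinor.encard_neighborSet_le ⟨helem, hpair⟩)) (by decide)

theorem mem_range_pair_iff [Nontrivial G] {v : Vertex G} :
    v ∈ Set.range pair ↔ ((gadgetGraph G).neighborSet v).encard = 3 := by
  constructor
  · rintro ⟨x, rfl⟩
    exact encard_neighborSet_pair x
  · refine fun hdeg => by_contra fun hpair => ?_
    by_cases helem : v ∈ Set.range elem
    · exact absurd (hdeg ▸ mem_range_elem_iff.1 helem) (by decide)
    · exact absurd (hdeg ▸ IsMinor.encard_neighborSet_le ⟨helem, hpair⟩) (by decide)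

end Vertex

/-! ### Version II is bounded by Version III -/

namespace Vertex

variable {G : Type*}

theorem comp_isSide_pair_iff {s : Bool} {x y : Bool → G} :
    Relation.Comp (Function.swap (IsSide s)) (IsSide s) (pair x) (pair y) ↔ x s = y s := by
  simp [Relation.Comp, Function.swap]

variable [Group G]

theorem eq_elem_one_iff {z : Vertex G} :
    z = elem 1 ↔ ∃ v, (IsSide false z v ∧ IsSide true z v) ∧ IsProd z v := by
  constructor
  · rintro rfl
    exact ⟨pair 1, by simp⟩
  · rintro ⟨_, ⟨⟨x, rfl, rfl⟩, htrue⟩, hprod⟩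
    rw [isSide_pair, elem_injective.eq_iff] at htrue
    rw [isProd_pair, elem_injective.eq_iff, ← htrue, left_eq_mul] at hprod
    rw [hprod]

theorem eq_elem_mul_iff {z : Vertex G} {x y : G} :
    z = elem (x * y) ↔ ∃ v, (IsProd z v ∧ IsSide false (elem x) v) ∧ IsSide true (elem y) v := by
  constructor
  · rintro rfl
    exact ⟨pair fun s => cond s y x, by simp⟩
  · rintro ⟨_, ⟨⟨p, rfl, rfl⟩, hfalse⟩, htrue⟩
    rw [isSide_pair, elem_injective.eq_iff] at hfalse htrue
    rw [hfalse, htrue]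

theorem eq_elem_inv_iff {z : Vertex G} {x : G} :
    z = elem x⁻¹ ↔ ∃ v, (IsSide false z v ∧ IsSide true (elem x) v) ∧ IsProd (elem 1) v := by
  constructor
  · rintro rfl
    exact ⟨pair fun s => cond s x x⁻¹, by simp⟩
  · rintro ⟨_, ⟨⟨p, rfl, rfl⟩, htrue⟩, hprod⟩
    rw [isSide_pair, elem_injective.eq_iff] at htrue
    rw [isProd_pair, elem_injective.eq_iff, ← htrue, eq_comm, mul_eq_one_iff_eq_inv] at hprod
    rw [hprod]

end Vertex

section GadgetStrategy

open Function Vertex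

theorem three_le_card_sum_bool {μ : Type*} [Nonempty μ] : 3 ≤ ENat.card (μ ⊕ Bool) := by
  have hμ : 1 ≤ ENat.card μ := (ENat.one_le_card_iff_nonempty μ).2 ‹_›
  calc (3 : ℕ∞) = 1 + 2 := by norm_num
    _ ≤ ENat.card μ + ENat.card Bool := add_le_add hμ (by simp)
    _ = ENat.card (μ ⊕ Bool) := (ENat.card_sum μ Bool).symm

variable {ι κ μ : Type*} [DecidableEq ι] [DecidableEq κ] [DecidableEq μ] {G H : Type*} [Group G]
  [Group H] {R : (ι → Vertex G) → (ι → Vertex H) → Prop}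

/-- `R` is a winning condition for Duplicator in the pebble game on the vertices of `Γ_G` and `Γ_H`
under which related tuples agree on the structure of the gadgets. -/
structure GadgetStrategy (R : (ι → Vertex G) → (ι → Vertex H) → Prop) : Prop where
  backForth : BackForth R
  mem_range_elem : Preserves₁ R (· ∈ Set.range elem) (· ∈ Set.range elem)
  mem_range_pair : Preserves₁ R (· ∈ Set.range pair) (· ∈ Set.range pair)
  isSide (s : Bool) : Preserves₂ R (IsSide s) (IsSide s)
  isProd : Preserves₂ R IsProd IsProd

theorem GraphStrategy.gadgetStrategy [Nontrivial G] [Nontrivial H]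
    (hR : GraphStrategy (gadgetGraph G) (gadgetGraph H) R) (hι : 3 ≤ ENat.card ι) :
    GadgetStrategy R := by
  have : Nontrivial ι := (ENat.one_lt_card_iff_nontrivial ι).1 (lt_of_lt_of_le (by norm_num) hι)
  have helem : Preserves₁ R (· ∈ Set.range elem) (· ∈ Set.range elem) := by
    simpa only [mem_range_elem_iff] using hR.preserves_encard_neighborSet (4 ≤ ·)
  have hpair : Preserves₁ R (· ∈ Set.range pair) (· ∈ Set.range pair) := by
    simpa only [mem_range_pair_iff] using hR.preserves_encard_neighborSet (· = 3)
  have hends := helem.left.and hpair.right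
  have hminor : Preserves₁ R IsMinor IsMinor := helem.not.and hpair.not
  have hstep := hR.preserves_adj.and hminor.right
  refine ⟨hR.backForth, helem, hpair, fun s => ?_, ?_⟩
  · cases s
    · have := (hstep.comp hR.preserves_adj hR.backForth hι).and hends
      exact fun v w hvw i j hij => by
        simpa only [isSide_false_iff] using this hvw hij
    · have := hR.preserves_adj.and hends
      exact fun v w hvw i j hij => by
        simpa only [isSide_true_iff] using this hvw hij
  · have := ((hstep.comp hstep hR.backForth hι).comp hR.preserves_adj hR.backForth hι).and hends
    exact fun v w hvw i j hij => by
      simpa only [isProd_iff] using this hvw hij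

theorem GadgetStrategy.fix_left {R : (κ ⊕ ι → Vertex G) → (κ ⊕ ι → Vertex H) → Prop}
    (hR : GadgetStrategy R) (a : κ → Vertex G) (b : κ → Vertex H) :
    GadgetStrategy fun u u' => R (Sum.elim a u) (Sum.elim b u') where
  backForth := hR.backForth.fix_left a b
  mem_range_elem _ _ h i := hR.mem_range_elem h (.inr i)
  mem_range_pair _ _ h i := hR.mem_range_pair h (.inr i)
  isSide s _ _ h _ _ hij := hR.isSide s h (Sum.inr_injective.ne hij)
  isProd _ _ h _ _ hij := hR.isProd h (Sum.inr_injective.ne hij)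

/-- The pairs of group elements that Duplicator always matches with each other. -/
def GadgetStrategy.matched [Nontrivial ι] (hR : GadgetStrategy R) : Subgroup (G × H) where
  carrier := {p | Preserves₁ R (· = elem p.1) (· = elem p.2)}
  one_mem' := by
    simpa only [Set.mem_ofPred_eq, Prod.fst_one, Prod.snd_one, eq_elem_one_iff] using
      (((hR.isSide false).and (hR.isSide true)).and hR.isProd).exists hR.backForth
  mul_mem' {p q} hp hq := by
    simpa only [Set.mem_ofPred_eq, Prod.fst_mul, Prod.snd_mul, eq_elem_mul_iff] using
      ((hR.isProd.and ((hR.isSide false).of_preserves_eq hp hR.backForth).right).and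
        ((hR.isSide true).of_preserves_eq hq hR.backForth).right).exists hR.backForth
  inv_mem' {p} hp := by
    have hone : Preserves₁ R (· = elem (1 : G)) (· = elem (1 : H)) := by
      simpa only [eq_elem_one_iff] using
        (((hR.isSide false).and (hR.isSide true)).and hR.isProd).exists hR.backForth
    simpa only [Set.mem_ofPred_eq, Prod.fst_inv, Prod.snd_inv, eq_elem_inv_iff] using
      (((hR.isSide false).and ((hR.isSide true).of_preserves_eq hp hR.backForth).right).and
        (hR.isProd.of_preserves_eq hone hR.backForth).right).exists hR.backForth

theorem GadgetStrategy.fst_eq_one_iff_of_mem_matched [Nontrivial ι] (hR : GadgetStrategy R)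
    {u : ι → Vertex G} {u' : ι → Vertex H} (huu' : R u u') {p : G × H} (hp : p ∈ hR.matched) :
    p.1 = 1 ↔ p.2 = 1 := by
  inhabit ι
  obtain ⟨f, hf⟩ := hR.backForth u u' huu'
  have hplay := hf (elem p.1) default
  have hanswer : f (elem p.1) = elem p.2 := by simpa using hp hplay default
  simpa [hanswer, elem_injective.eq_iff] using hR.matched.one_mem hplay default

theorem GadgetStrategy.eq_pair_update (hR : GadgetStrategy R) (hι : 3 ≤ ENat.card ι)
    {v : ι → Vertex G} {w : ι → Vertex H} {p q r : ι} (hpq : p ≠ q) (hpr : p ≠ r) (hqr : q ≠ r)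
    {x : Bool → G} {y y' : Bool → H} (hvp : v p = pair x) (hwp : w p = pair y)
    {s : Bool} {x₁ : G} {y₁ : H}
    (h : R (update (update v q (elem x₁)) r (pair (update x s x₁)))
      (update (update w q (elem y₁)) r (pair y'))) : y' = update y s y₁ := by
  have hside : y' s = y₁ := by
    simpa [hqr, elem_injective.eq_iff, eq_comm] using hR.isSide s h hqr
  have hother : y' (!s) = y (!s) := by
    have hcommon := ((hR.isSide !s).swap.comp (hR.isSide !s) hR.backForth hι) h hpr
    simpa [hpq, hpr, hvp, hwp, comp_isSide_pair_iff, eq_comm] using hcommon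
  exact eq_update_iff.2 ⟨hside, fun t hts => Bool.eq_not.2 hts ▸ hother⟩

/-- Duplicator is winning when the group elements `g`, `h` are pebbled two at a time, by the
vertices that represent the pairs `(g (i, false), g (i, true))`. The two further pebbles, on `Bool`,
are arbitrary. -/
def PairedRel (R : (μ ⊕ Bool → Vertex G) → (μ ⊕ Bool → Vertex H) → Prop)
    (g : μ × Bool → G) (h : μ × Bool → H) : Prop :=
  ∃ u u', R (Sum.elim (pair ∘ curry g) u) (Sum.elim (pair ∘ curry h) u')

variable {R : (μ ⊕ Bool → Vertex G) → (μ ⊕ Bool → Vertex H) → Prop}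

theorem GadgetStrategy.exists_pairedRel (hR : GadgetStrategy R) {w : μ ⊕ Bool → Vertex H}
    (hw : R (fun _ => pair 1) w) : ∃ h, PairedRel R 1 h := by
  choose y hy using fun j => (hR.mem_range_pair hw j).1 ⟨1, rfl⟩
  refine ⟨uncurry (y ∘ .inl), fun _ => pair 1, w ∘ .inr, ?_⟩
  convert hw using 1
  · exact funext (Sum.rec (fun _ => rfl) fun _ => rfl)
  · exact funext (Sum.rec (fun i => hy (.inl i)) fun _ => rfl)

theorem GadgetStrategy.backForth_pairedRel (hR : GadgetStrategy R) : BackForth (PairedRel R) := by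
  rintro g h ⟨u, u', huu'⟩
  obtain ⟨f, hf⟩ := hR.backForth.exists_equiv_range elem_injective elem_injective
    hR.mem_range_elem huu'
  refine ⟨f, fun x ⟨i, s⟩ => ⟨update u false (elem x), update u' false (elem (f x)), ?_⟩⟩
  have : Nonempty μ := ⟨i⟩
  obtain ⟨F, hF⟩ := hR.backForth.exists_equiv_range pair_injective pair_injective
    hR.mem_range_pair (hf x (.inr false))
  -- The pebble on `x` and the old pebble at `i` determine Duplicator's answer to the new pair.
  have hanswer : F (update (curry g i) s x) = update (curry h i) s (f x) :=
    hR.eq_pair_update (p := .inl i) three_le_card_sum_bool Sum.inl_ne_inr Sum.inl_ne_inr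
      (by simp) rfl rfl (hF (update (curry g i) s x) (.inr true))
  have hresult := hF (update (curry g i) s x) (.inl i)
  rw [hanswer, update_comm Sum.inr_ne_inl, update_comm Sum.inr_ne_inl] at hresult
  simpa only [curry_update, comp_update, Sum.elim_update_left, Sum.elim_update_right] using hresult

theorem GadgetStrategy.markedGroupIso {k : ℕ} (hR : GadgetStrategy R) {g : μ × Bool → G}
    {h : μ × Bool → H} (hgh : PairedRel R g h) (e : Fin k → μ × Bool) :
    MarkedGroupIso (g ∘ e) (h ∘ e) := by
  obtain ⟨u, u', huu'⟩ := hgh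
  have hfix := hR.fix_left (pair ∘ curry g) (pair ∘ curry h)
  refine markedGroupIso_of_subgroup hfix.matched
    (fun p hp => hfix.fst_eq_one_iff_of_mem_matched huu' hp) fun i => ?_
  intro v w hvw j
  simpa using hR.isSide (e i).2 hvw (i := .inr j) (j := .inl (e i).1) (by simp)

end GadgetStrategy

theorem wlEquiv_II_of_subsingleton {k : ℕ} {G H : Type u} [Group G] [Group H] [Fintype G]
    [Fintype H] [Subsingleton (Fin k → G)] (f : G ≃ H) : WLEquiv .II k G H := by
  have hH : Subsingleton (Fin k → H) := (Equiv.arrowCongr (.refl (Fin k)) f).symm.subsingleton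
  have hiso (g : Fin k → G) (h : Fin k → H) : MarkedGroupIso g h := by
    rw [Subsingleton.elim g 1, Subsingleton.elim h 1]
    exact markedGroupIso_of_subgroup ⊥ (by simp) fun _ => Subgroup.one_mem _
  have hR : BackForth fun (_ : Fin k → G) (_ : Fin k → H) => True :=
    fun _ _ _ => ⟨f, fun _ _ => trivial⟩
  exact ⟨Equiv.arrowCongr (.refl _) f,
    fun g => hR.sameFinalColor (fun g h _ => initII_eq_iff.2 (hiso g h)) trivial⟩

theorem wlLe_II_III {k m : ℕ} (hk : k ≤ 2 * m) : WLLe.{u} .II k .III (m + 2) := by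
  rintro G H _ _ _ _ ⟨E, hE⟩
  have hcard : Fintype.card G = Fintype.card H := by
    have hpow := Fintype.card_congr E
    rw [Fintype.card_pi_const, Fintype.card_pi_const] at hpow
    exact Nat.pow_left_injective (by omega) hpow
  have f : G ≃ H := Fintype.equivOfCardEq hcard
  obtain hsubsingleton | hnontrivial := subsingleton_or_nontrivial (Fin k → G)
  · exact wlEquiv_II_of_subsingleton f
  obtain ⟨g, g', hg⟩ := exists_pair_ne (Fin k → G)
  obtain ⟨i, hi⟩ := Function.ne_iff.1 hg
  have hG : Nontrivial G := ⟨g i, g' i, hi⟩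
  have hH : Nontrivial H := f.symm.nontrivial
  have hm : Nonempty (Fin m) := Fin.pos_iff_nonempty.1 (by have := i.pos; omega)
  obtain ⟨e⟩ : Nonempty (Fin m ⊕ Bool ↪ Fin (m + 2)) :=
    Function.Embedding.nonempty_of_card_le (by simp)
  obtain ⟨e'⟩ : Nonempty (Fin k ↪ Fin m × Bool) :=
    Function.Embedding.nonempty_of_card_le (by simpa [mul_comm m 2] using hk)
  have hgraph := graphStrategy_sameFinalColor (k := m + 2) (gadgetGraph G) (gadgetGraph H)
  have hR := (hgraph.restrict e).gadgetStrategy three_le_card_sum_bool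
  obtain ⟨F, hF⟩ := hgraph.backForth.exists_equiv (hE 1)
  obtain ⟨h, hh⟩ := hR.exists_pairedRel ⟨fun _ => .pair 1, _, hF _, rfl, rfl⟩
  have hS := hR.backForth_pairedRel.restrict e'
  obtain ⟨E', hE'⟩ := hS.exists_equiv ⟨1, h, hh, rfl, rfl⟩
  refine ⟨E', fun g => hS.sameFinalColor ?_ (hE' g)⟩
  rintro _ _ ⟨g, h, hgh, rfl, rfl⟩
  exact initII_eq_iff.2 (hR.markedGroupIso hgh e')

end GroupWL

/-- In natural-number division, `(k + 1) / 2` is `⌈k/2⌉` and `k / 2` is `⌊k/2⌋`. For even `k` both are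
`k/2`, and the third and the fourth part say the same. -/
theorem mainTheorem2 (k : ℕ) :
    GroupWL.WLLe.{u} .I k .II k ∧
    GroupWL.WLLe.{u} .II k .III ((k + 1) / 2 + 2) ∧
    GroupWL.WLLe.{u} .III ((k + 1) / 2 + 2) .I (2 * ((k + 1) / 2) + 5) ∧
    GroupWL.WLLe.{u} .III (k / 2 + 2) .I (k + 5) :=
  ⟨GroupWL.wlLe_I_II k, GroupWL.wlLe_II_III (by omega), GroupWL.wlLe_III_I (by omega),
    GroupWL.wlLe_III_I (by omega)⟩
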